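/- Let $\sigma:\mathbf R\to\mathbf R$ be a $C^2$ function of one of the following two types. Type I (quadratic-like): $\sigma$ is strictly convex on $\mathbf R$ and attains its minimum, at a point $\alpha$, and $\sigma''(w)>0$ for all $w\le\alpha$. Type II (cubic-like): there are $\alpha<\beta$ such that $\sigma'(w)<0$ for $w<\alpha$ and for $w>\beta$, $\sigma'(w)>0$ for $w\in(\alpha,\beta)$, $\sigma''(w)>0$ for $w\le\alpha$, and $\sigma''(w)<0$ for $w\ge\beta$. Let $u,v:\mathbf R\times\mathbf R\to\mathbf R$ be $C^2$ functions of $(t,x)$ satisfying $$u_t=-v_x,\qquad v_t=(\sigma(u))_x$$ for all $(t,x)\in\mathbf R\times\mathbf R$. Suppose that $u$ is bounded on $\mathbf R\times\mathbf R$ and that $u(t,x+1)=u(t,x)$ for all $t,x$ (no periodicity of $v$ is assumed). Then $u$ and $v$ are both constant on $\mathbf R\times\mathbf R$. -/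

import Mathlib

namespace PSystem

/-- Quadratic-like nonlinearity: a `C²`, strictly convex function on the line attaining its minimum,
at `α` say, which is nondegenerate (`σ'' > 0`, genuine nonlinearity) on the closed half line
`u ≤ α`, the closure of the set of hyperbolic states. -/
structure IsTypeI (σ : ℝ → ℝ) : Prop where
  contDiff : ContDiff ℝ 2 σ
  strictConvex : StrictConvexOn ℝ Set.univ σ
  exists_min : ∃ α : ℝ, IsMinOn σ Set.univ α ∧ ∀ w ≤ α, 0 < deriv (deriv σ) w

/-- Cubic-like nonlinearity: a `C²` function on the line which decreases on `(-∞, α)` and on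
`(β, ∞)`, increases on `(α, β)`, with `σ'' > 0` on `(-∞, α]` and `σ'' < 0` on `[β, ∞)`. -/
structure IsTypeII (σ : ℝ → ℝ) : Prop where
  contDiff : ContDiff ℝ 2 σ
  exists_zones : ∃ α β : ℝ, α < β ∧
    (∀ w < α, deriv σ w < 0) ∧
    (∀ w > β, deriv σ w < 0) ∧
    (∀ w ∈ Set.Ioo α β, 0 < deriv σ w) ∧
    (∀ w ≤ α, 0 < deriv (deriv σ) w) ∧
    (∀ w ≥ β, deriv (deriv σ) w < 0)

/-- `(u, v)` is a `C²` solution, on all of `ℝ × ℝ` with coordinates `(t, x)`, of the p-system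
`u_t = -v_x`, `v_t = (σ(u))_x`. -/
structure IsC2Solution (σ : ℝ → ℝ) (u v : ℝ → ℝ → ℝ) : Prop where
  contDiff_u : ContDiff ℝ 2 (fun p : ℝ × ℝ => u p.1 p.2)
  contDiff_v : ContDiff ℝ 2 (fun p : ℝ × ℝ => v p.1 p.2)
  eq_u : ∀ t x : ℝ, deriv (fun s => u s x) t = -deriv (fun y => v t y) x
  eq_v : ∀ t x : ℝ, deriv (fun s => v s x) t = deriv (fun y => σ (u t y)) x

end PSystem

open MeasureTheory Filter Topology

namespace PSystem

/-! ### Differential inequalities on the whole line, and a Hölder inequality. -/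

section Calculus

/-! Write `a = v_x = -u_t` and `b = u_x`; both inherit their period from `u`. Two integrals over a
period, considered for all times, force `a = b = 0`.

Elliptic states (`σ'(u) > 0`): choose `f` with `f'' = max 0 σ'`. The second time derivative of `∫
f(u)` is `∫ f''(u) (a² + σ'(u) b²) ≥ 0`, and a bounded convex function on the line is constant, so
`a = b = 0` wherever `σ'(u) > 0` (`eq_zero_of_elliptic`). Hence `(max 0 σ'(u))²` is constant: the
gradient vanishes identically or `σ'(u) ≤ 0` everywhere.

Hyperbolic states: with `c = ±√(-σ'(u))` and `p = a + c b`, one has `(c² p⁵)_t + (c³ p⁵)_x = σ''(u)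
p⁶`, which stays regular where `c = 0`. When `σ''` has a fixed sign on the range of `u`, Hölder
gives `Y' ≥ k |Y|^(6/5)` for `Y = ±∫ c² p⁵`. A nonzero `Y` would blow up in finite forward or
backward time, so `Y = 0` and then `p = 0` (`riemannInvariant_deriv_eq_zero`). Both signs of `c`
together give `a = 0` and `c b = 0`.

For either type of `σ`, the condition `σ'(u) ≤ 0` and connectedness of the plane confine `u` to one
zone where `σ''` has a sign. -/

theorem hasDerivAt_intervalIntegral_of_continuous {F Ft : ℝ → ℝ → ℝ}
    (hF : Continuous fun p : ℝ × ℝ => F p.1 p.2) (hFt : Continuous fun p : ℝ × ℝ => Ft p.1 p.2)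
    (h : ∀ t x, HasDerivAt (fun s => F s x) (Ft t x) t) (a b t : ℝ) :
    HasDerivAt (fun s => ∫ x in a..b, F s x) (∫ x in a..b, Ft t x) t := by
  have hK : IsCompact (Metric.closedBall t 1 ×ˢ Set.uIcc a b) :=
    (isCompact_closedBall t 1).prod isCompact_uIcc
  obtain ⟨C, hC⟩ := hK.exists_bound_of_continuousOn hFt.continuousOn
  have hs : ∀ s, Continuous (F s) := fun s => hF.comp (by fun_prop : Continuous fun x : ℝ => (s, x))
  have hst : Continuous (Ft t) := hFt.comp (by fun_prop : Continuous fun x : ℝ => (t, x))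
  refine (intervalIntegral.hasDerivAt_integral_of_dominated_loc_of_deriv_le
    (F := F) (F' := Ft) (bound := fun _ => C) (s := Metric.closedBall t 1)
    (Metric.closedBall_mem_nhds t one_pos)
    (Eventually.of_forall fun s => (hs s).aestronglyMeasurable)
    ((hs t).intervalIntegrable a b) hst.aestronglyMeasurable ?_ intervalIntegrable_const ?_).2
  · exact Eventually.of_forall fun x hx s hs => hC (s, x) ⟨hs, Set.uIoc_subset_uIcc hx⟩
  · exact Eventually.of_forall fun x _ s _ => h s x

/-- The balance law `F_t + J_x = g`, integrated over a period of the flux `J`. -/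
theorem hasDerivAt_integral_of_balance {F Ft J Jx g : ℝ → ℝ → ℝ}
    (hF : Continuous fun p : ℝ × ℝ => F p.1 p.2) (hFt : Continuous fun p : ℝ × ℝ => Ft p.1 p.2)
    (hJx : Continuous fun p : ℝ × ℝ => Jx p.1 p.2)
    (hdF : ∀ t x, HasDerivAt (fun s => F s x) (Ft t x) t)
    (hdJ : ∀ t x, HasDerivAt (J t) (Jx t x) x)
    (hper : ∀ t x, J t (x + 1) = J t x) (hbal : ∀ t x, Ft t x + Jx t x = g t x) (x₀ t : ℝ) :
    HasDerivAt (fun s => ∫ x in x₀..x₀ + 1, F s x) (∫ x in x₀..x₀ + 1, g t x) t := by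
  convert hasDerivAt_intervalIntegral_of_continuous hF hFt hdF x₀ (x₀ + 1) t using 1
  have hc1 : Continuous (Ft t) := hFt.comp (by fun_prop : Continuous fun x : ℝ => (t, x))
  have hc2 : Continuous (Jx t) := hJx.comp (by fun_prop : Continuous fun x : ℝ => (t, x))
  have h0 := intervalIntegral.integral_eq_sub_of_hasDerivAt (a := x₀) (b := x₀ + 1)
    (fun x _ => hdJ t x) (hc2.intervalIntegrable _ _)
  simp only [← hbal]
  rw [intervalIntegral.integral_add (hc1.intervalIntegrable _ _) (hc2.intervalIntegrable _ _), h0,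
    hper, sub_self, add_zero]

/-- A continuous nonnegative function whose integral over `[x₀, x₀ + 1]` vanishes is zero at `x₀`. -/
theorem eq_zero_of_integral_eq_zero {g : ℝ → ℝ} (hg : Continuous g) (h0 : ∀ x, 0 ≤ g x) {x₀ : ℝ}
    (h : ∫ x in x₀..x₀ + 1, g x = 0) : g x₀ = 0 := by
  by_contra hne
  have := intervalIntegral.integral_pos (lt_add_one x₀) hg.continuousOn (fun x _ => h0 x)
    ⟨x₀, by simp, lt_of_le_of_ne (h0 x₀) (Ne.symm hne)⟩
  linarith

theorem not_pos_of_bounded_of_monotone_deriv {G G' : ℝ → ℝ} (hG : ∀ t, HasDerivAt G (G' t) t)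
    (hmono : Monotone G') {K : ℝ} (hK : ∀ t, |G t| ≤ K) (t : ℝ) : G' t ≤ 0 := by
  by_contra! hpos
  have hd : Differentiable ℝ G := fun s => (hG s).differentiableAt
  -- By time `s` the function has grown by at least `2 * K + 1`, more than the bound `K` allows.
  set s := t + (2 * K + 1) / G' t with hs
  have hK0 : 0 ≤ K := (abs_nonneg _).trans (hK t)
  have hts : t ≤ s := by
    have : 0 ≤ (2 * K + 1) / G' t := by positivity
    linarith
  have := (convex_Ici t).mul_sub_le_image_sub_of_le_deriv (f := G) (C := G' t) hd.continuous.continuousOn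
    hd.differentiableOn (fun r hr => by
      rw [interior_Ici] at hr
      rw [(hG r).deriv]
      exact hmono (le_of_lt hr)) t (by simp) s hts hts
  have h2 : G' t * (s - t) = 2 * K + 1 := by rw [hs]; field_simp; ring
  have h3 := abs_le.1 (hK t)
  have h4 := abs_le.1 (hK s)
  linarith

/-- A bounded function on the line with nonnegative second derivative has zero second derivative. -/
theorem second_deriv_eq_zero_of_bounded {G G' G'' : ℝ → ℝ} (hG : ∀ t, HasDerivAt G (G' t) t)
    (hG' : ∀ t, HasDerivAt G' (G'' t) t) (h0 : ∀ t, 0 ≤ G'' t) {K : ℝ} (hK : ∀ t, |G t| ≤ K)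
    (t : ℝ) : G'' t = 0 := by
  have hmono : Monotone G' := monotone_of_hasDerivAt_nonneg hG' h0
  have hle := not_pos_of_bounded_of_monotone_deriv hG hmono hK
  have hge := not_pos_of_bounded_of_monotone_deriv (G := fun s => G (-s)) (G' := fun s => -G' (-s))
    (fun s => by simpa [Function.comp_def] using (hG (-s)).scomp s (hasDerivAt_neg s))
    (fun r s hrs => neg_le_neg (hmono (neg_le_neg hrs))) (fun s => hK (-s))
  have hz : G' = fun _ => 0 := funext fun s => le_antisymm (hle s) (by simpa using hge (-s))
  have := hG' t
  rw [hz] at this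
  exact this.unique (hasDerivAt_const t 0)

/-- While `y > 0`, the positive quantity `y ^ (-1/5)` falls at rate at least `k / 5`, so it would
reach zero by the finite time `t₁`. -/
theorem not_pos_of_superlinear_growth {y y' : ℝ → ℝ} (hy : ∀ t, HasDerivAt y (y' t) t) {k : ℝ}
    (hk : 0 < k) (h : ∀ t, k * |y t| ^ (6 / 5 : ℝ) ≤ y' t) (t₀ : ℝ) : y t₀ ≤ 0 := by
  by_contra! hpos
  have hmono : Monotone y := monotone_of_hasDerivAt_nonneg hy fun t =>
    le_trans (by positivity) (h t)
  have hp : ∀ t, t₀ ≤ t → 0 < y t := fun t ht => hpos.trans_le (hmono ht)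
  have hz : ∀ t, t₀ ≤ t → HasDerivAt (fun s => y s ^ (-(1 / 5) : ℝ))
      (y' t * (-(1 / 5)) * y t ^ (-(1 / 5) - 1 : ℝ)) t := fun t ht =>
    (hy t).rpow_const (Or.inl (hp t ht).ne')
  set t₁ := t₀ + (5 / k) * y t₀ ^ (-(1 / 5) : ℝ) with ht₁
  have hle : t₀ ≤ t₁ := by
    have : 0 ≤ (5 / k) * y t₀ ^ (-(1 / 5) : ℝ) := by positivity
    linarith
  have key := (convex_Ici t₀).image_sub_le_mul_sub_of_deriv_le
    (f := fun s => y s ^ (-(1 / 5) : ℝ)) (C := -(k / 5))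
    (fun s hs => (hz s hs).continuousAt.continuousWithinAt)
    (fun s hs => (hz s (interior_subset hs)).differentiableAt.differentiableWithinAt)
    (fun s hs => by
      have hs' : t₀ ≤ s := interior_subset hs
      rw [(hz s hs').deriv]
      have h1 := h s
      have hys := hp s hs'
      rw [abs_of_pos hys] at h1
      have h2 : y s ^ (6 / 5 : ℝ) * y s ^ (-(1 / 5) - 1 : ℝ) = 1 := by
        rw [← Real.rpow_add hys]; norm_num
      have h3 : 0 < y s ^ (-(1 / 5) - 1 : ℝ) := by positivity
      have h4 := mul_le_mul_of_nonneg_right h1 h3.le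
      rw [mul_assoc, h2] at h4
      linarith) t₀ (by simp) t₁ hle hle
  have h5 : 0 < y t₁ ^ (-(1 / 5) : ℝ) := Real.rpow_pos_of_pos (hp t₁ hle) _
  have h6 : -(k / 5) * (t₁ - t₀) = -y t₀ ^ (-(1 / 5) : ℝ) := by rw [ht₁]; field_simp; ring
  linarith

/-- The only solution of `y' ≥ k |y| ^ (6 / 5)` on the whole line is zero. -/
theorem eq_zero_of_superlinear_growth {y y' : ℝ → ℝ} (hy : ∀ t, HasDerivAt y (y' t) t) {k : ℝ}
    (hk : 0 < k) (h : ∀ t, k * |y t| ^ (6 / 5 : ℝ) ≤ y' t) (t : ℝ) : y t = 0 := by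
  refine le_antisymm (not_pos_of_superlinear_growth hy hk h t) ?_
  -- The hypothesis is invariant under `y ↦ -y(-t)`.
  have := not_pos_of_superlinear_growth (y := fun s => -y (-s)) (y' := fun s => y' (-s))
    (fun s => by simpa [Function.comp_def] using ((hy (-s)).scomp s (hasDerivAt_neg s)).fun_neg) hk
    (fun s => by simpa using h (-s)) (-t)
  simpa using this

theorem six_mul_mul_pow_five_le {s q : ℝ} (hs : 0 ≤ s) (hq : 0 ≤ q) :
    6 * s * q ^ 5 ≤ 5 * q ^ 6 + s ^ 6 := by
  have : 0 ≤ (q - s) ^ 2 * (5 * q ^ 4 + 4 * q ^ 3 * s + 3 * q ^ 2 * s ^ 2 + 2 * q * s ^ 3 + s ^ 4) := by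
    positivity
  linarith [this, show (q - s) ^ 2 * (5 * q ^ 4 + 4 * q ^ 3 * s + 3 * q ^ 2 * s ^ 2 + 2 * q * s ^ 3
    + s ^ 4) = 5 * q ^ 6 - 6 * s * q ^ 5 + s ^ 6 by ring]

/-- Hölder's inequality between the fifth and the sixth moment on an interval of length one. -/
theorem rpow_abs_integral_le {F p : ℝ → ℝ} (hF : Continuous F) (hp : Continuous p) {N : ℝ}
    (hN : 0 < N) (h : ∀ x, |F x| ≤ N * |p x| ^ 5) (x₀ : ℝ) :
    |∫ x in x₀..x₀ + 1, F x| ^ (6 / 5 : ℝ) ≤ N ^ (6 / 5 : ℝ) * ∫ x in x₀..x₀ + 1, p x ^ 6 := by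
  set Y := |∫ x in x₀..x₀ + 1, F x| with hY
  set B := ∫ x in x₀..x₀ + 1, p x ^ 6 with hB
  have hY0 : 0 ≤ Y := abs_nonneg _
  -- Integrating Young's inequality gives `6 s Y ≤ N (5 B + s ^ 6)`; since `Y = N s ^ 5`, this
  -- choice leaves `s ^ 6 ≤ B`.
  set s := (Y / N) ^ (1 / 5 : ℝ) with hs
  have hs0 : 0 ≤ s := by positivity
  have hs5 : s ^ 5 = Y / N := by
    rw [hs, ← Real.rpow_natCast, ← Real.rpow_mul (by positivity)]; norm_num
  have hs6 : s ^ 6 = Y ^ (6 / 5 : ℝ) / N ^ (6 / 5 : ℝ) := by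
    rw [hs, ← Real.rpow_natCast, ← Real.rpow_mul (by positivity), ← Real.div_rpow hY0 hN.le]
    norm_num
  have hle : x₀ ≤ x₀ + 1 := by linarith
  have h1 : Y ≤ ∫ x in x₀..x₀ + 1, |F x| := intervalIntegral.abs_integral_le_integral_abs hle
  have h2 : ∫ x in x₀..x₀ + 1, 6 * s * |F x| ≤ ∫ x in x₀..x₀ + 1, (N * 5 * p x ^ 6 + N * s ^ 6) := by
    refine intervalIntegral.integral_mono_on hle
      (Continuous.intervalIntegrable (by fun_prop) _ _)
      (Continuous.intervalIntegrable (by fun_prop) _ _) fun x _ => ?_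
    have h3 := six_mul_mul_pow_five_le hs0 (abs_nonneg (p x))
    rw [show |p x| ^ 6 = p x ^ 6 from (by decide : Even 6).pow_abs (p x)] at h3
    calc 6 * s * |F x| ≤ 6 * s * (N * |p x| ^ 5) := by gcongr; exact h x
      _ = N * (6 * s * |p x| ^ 5) := by ring
      _ ≤ N * (5 * p x ^ 6 + s ^ 6) := by gcongr
      _ = _ := by ring
  rw [intervalIntegral.integral_const_mul, intervalIntegral.integral_add
    (Continuous.intervalIntegrable (by fun_prop) _ _) intervalIntegrable_const,
    intervalIntegral.integral_const_mul, intervalIntegral.integral_const, ← hB] at h2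
  simp only [add_sub_cancel_left, one_smul] at h2
  have h4 : 6 * s * Y ≤ 6 * s * ∫ x in x₀..x₀ + 1, |F x| := by gcongr
  have h5 : 6 * s * Y = N * (6 * s ^ 6) := by
    have : Y = N * s ^ 5 := by rw [hs5]; field_simp
    rw [this]; ring
  have h6 : s ^ 6 ≤ B := by
    have : N * (6 * s ^ 6) ≤ N * (5 * B + s ^ 6) := by linarith
    linarith [le_of_mul_le_mul_left this hN]
  rw [hs6, div_le_iff₀ (by positivity)] at h6
  linarith

/-- Squaring removes the corner of the positive part: near `0` the function is dominated by `w ^ 2`.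
-/
theorem hasDerivAt_max_zero_sq (z : ℝ) :
    HasDerivAt (fun w : ℝ => max 0 w ^ 2) (2 * max 0 z) z := by
  rcases lt_trichotomy z 0 with hz | rfl | hz
  · rw [max_eq_left hz.le, mul_zero]
    refine (hasDerivAt_const z (0 : ℝ)).congr_of_eventuallyEq ?_
    filter_upwards [Iio_mem_nhds hz] with w hw
    simp [max_eq_left (Set.mem_Iio.1 hw).le]
  · have h : HasDerivAt (fun w : ℝ => w ^ 2) 0 0 := by simpa using hasDerivAt_pow 2 (0 : ℝ)
    rw [max_self, mul_zero]
    rw [hasDerivAt_iff_isLittleO] at h ⊢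
    refine Asymptotics.IsBigO.trans_isLittleO (Asymptotics.IsBigO.of_bound 1 ?_) h
    refine Eventually.of_forall fun w => ?_
    rcases le_total w 0 with hw | hw
    · simp [max_eq_left hw]; positivity
    · simp [max_eq_right hw]
  · rw [max_eq_right hz.le]
    have h : HasDerivAt (fun w : ℝ => w ^ 2) (2 * z) z := by simpa using hasDerivAt_pow 2 z
    refine h.congr_of_eventuallyEq ?_
    filter_upwards [Ioi_mem_nhds hz] with w hw
    simp [max_eq_right (Set.mem_Ioi.1 hw).le]

end Calculus

/-! ### Partial derivatives of functions on the plane. -/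

section PartialDerivatives

variable {f : ℝ → ℝ → ℝ}

theorem hasDerivAt_fst (hf : Differentiable ℝ fun p : ℝ × ℝ => f p.1 p.2) (t x : ℝ) :
    HasDerivAt (fun s => f s x) (fderiv ℝ (fun p : ℝ × ℝ => f p.1 p.2) (t, x) (1, 0)) t :=
  HasFDerivAt.comp_hasDerivAt (f := fun s : ℝ => (s, x)) t (hf (t, x)).hasFDerivAt
    ((hasDerivAt_id t).prodMk (hasDerivAt_const t x))

theorem hasDerivAt_snd (hf : Differentiable ℝ fun p : ℝ × ℝ => f p.1 p.2) (t x : ℝ) :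
    HasDerivAt (f t) (fderiv ℝ (fun p : ℝ × ℝ => f p.1 p.2) (t, x) (0, 1)) x :=
  HasFDerivAt.comp_hasDerivAt (f := fun y : ℝ => (t, y)) x (hf (t, x)).hasFDerivAt
    ((hasDerivAt_const x t).prodMk (hasDerivAt_id x))

theorem contDiff_fderiv_apply (hf : ContDiff ℝ 2 fun p : ℝ × ℝ => f p.1 p.2) (e : ℝ × ℝ) :
    ContDiff ℝ 1 fun p : ℝ × ℝ => fderiv ℝ (fun p : ℝ × ℝ => f p.1 p.2) (p.1, p.2) e :=
  (hf.fderiv_right (m := 1) (by norm_num)).clm_apply contDiff_const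

theorem fderiv_fderiv_comm (hf : ContDiff ℝ 2 fun p : ℝ × ℝ => f p.1 p.2) (p e e' : ℝ × ℝ) :
    fderiv ℝ (fun p : ℝ × ℝ => fderiv ℝ (fun p : ℝ × ℝ => f p.1 p.2) (p.1, p.2) e) p e' =
      fderiv ℝ (fun p : ℝ × ℝ => fderiv ℝ (fun p : ℝ × ℝ => f p.1 p.2) (p.1, p.2) e') p e := by
  have hd : DifferentiableAt ℝ (fderiv ℝ fun p : ℝ × ℝ => f p.1 p.2) p :=
    (hf.fderiv_right (m := 1) (by norm_num)).differentiable (by norm_num) p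
  have h : ∀ e e' : ℝ × ℝ,
      fderiv ℝ (fun p : ℝ × ℝ => fderiv ℝ (fun p : ℝ × ℝ => f p.1 p.2) (p.1, p.2) e) p e' =
        fderiv ℝ (fderiv ℝ fun p : ℝ × ℝ => f p.1 p.2) p e' e := fun e e' => by
    have := (hd.hasFDerivAt.clm_apply (hasFDerivAt_const e p)).fderiv
    simp only [Prod.mk.eta]
    rw [this]
    simp
  rw [h, h]
  exact (hf.contDiffAt.isSymmSndFDerivAt (by simp)) e' e

end PartialDerivatives

/-! ### The differentiated system. -/

/-- The partial derivatives of a `C²` solution: `a = v_x = -u_t` and `b = u_x` are `C¹`, with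
`x`-derivatives `ax` and `bx`, and satisfy the differentiated system. -/
structure HasGradient (σ : ℝ → ℝ) (u v a b ax bx : ℝ → ℝ → ℝ) : Prop where
  contDiff_σ : ContDiff ℝ 2 σ
  continuous_u : Continuous fun p : ℝ × ℝ => u p.1 p.2
  continuous_a : Continuous fun p : ℝ × ℝ => a p.1 p.2
  continuous_b : Continuous fun p : ℝ × ℝ => b p.1 p.2
  continuous_ax : Continuous fun p : ℝ × ℝ => ax p.1 p.2
  continuous_bx : Continuous fun p : ℝ × ℝ => bx p.1 p.2
  u_t : ∀ t x, HasDerivAt (fun s => u s x) (-a t x) t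
  u_x : ∀ t x, HasDerivAt (u t) (b t x) x
  v_t : ∀ t x, HasDerivAt (fun s => v s x) (deriv σ (u t x) * b t x) t
  v_x : ∀ t x, HasDerivAt (v t) (a t x) x
  a_t : ∀ t x, HasDerivAt (fun s => a s x)
    (deriv (deriv σ) (u t x) * b t x ^ 2 + deriv σ (u t x) * bx t x) t
  a_x : ∀ t x, HasDerivAt (a t) (ax t x) x
  b_t : ∀ t x, HasDerivAt (fun s => b s x) (-ax t x) t
  b_x : ∀ t x, HasDerivAt (b t) (bx t x) x

theorem continuous_deriv_deriv {σ : ℝ → ℝ} (hσ : ContDiff ℝ 2 σ) :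
    Continuous (deriv (deriv σ)) :=
  (ContDiff.iterate_deriv' 0 2 (by simpa using hσ)).continuous

theorem hasDerivAt_deriv {σ : ℝ → ℝ} (hσ : ContDiff ℝ 2 σ) (w : ℝ) :
    HasDerivAt (deriv σ) (deriv (deriv σ) w) w :=
  ((ContDiff.deriv' (n := 1) (by norm_num; exact hσ)).differentiable (by norm_num) w).hasDerivAt

theorem IsC2Solution.exists_hasGradient {σ : ℝ → ℝ} {u v : ℝ → ℝ → ℝ} (hσ : ContDiff ℝ 2 σ)
    (h : IsC2Solution σ u v) : ∃ a b ax bx : ℝ → ℝ → ℝ, HasGradient σ u v a b ax bx := by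
  have hu := h.contDiff_u
  have hv := h.contDiff_v
  have hdu := hu.differentiable (by norm_num)
  have hdv := hv.differentiable (by norm_num)
  set a : ℝ → ℝ → ℝ := fun t x => fderiv ℝ (fun p : ℝ × ℝ => v p.1 p.2) (t, x) (0, 1) with ha
  set b : ℝ → ℝ → ℝ := fun t x => fderiv ℝ (fun p : ℝ × ℝ => u p.1 p.2) (t, x) (0, 1) with hb
  have hca : ContDiff ℝ 1 fun p : ℝ × ℝ => a p.1 p.2 := contDiff_fderiv_apply hv (0, 1)
  have hcb : ContDiff ℝ 1 fun p : ℝ × ℝ => b p.1 p.2 := contDiff_fderiv_apply hu (0, 1)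
  have hda := hca.differentiable (by norm_num)
  have hdb := hcb.differentiable (by norm_num)
  have hux : ∀ t x, HasDerivAt (u t) (b t x) x := hasDerivAt_snd hdu
  have hvx : ∀ t x, HasDerivAt (v t) (a t x) x := hasDerivAt_snd hdv
  have hut' : ∀ t x, fderiv ℝ (fun p : ℝ × ℝ => u p.1 p.2) (t, x) (1, 0) = -a t x := fun t x => by
    rw [← (hasDerivAt_fst hdu t x).deriv, h.eq_u, (hvx t x).deriv]
  have hvt' : ∀ t x, fderiv ℝ (fun p : ℝ × ℝ => v p.1 p.2) (t, x) (1, 0) =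
      deriv σ (u t x) * b t x := fun t x => by
    rw [← (hasDerivAt_fst hdv t x).deriv, h.eq_v]
    exact ((hσ.differentiable (by norm_num) (u t x)).hasDerivAt.comp x (hux t x)).deriv
  have hσu : ∀ t x, HasDerivAt (fun y => deriv σ (u t y) * b t y)
      (deriv (deriv σ) (u t x) * b t x ^ 2 + deriv σ (u t x) *
        fderiv ℝ (fun p : ℝ × ℝ => b p.1 p.2) (t, x) (0, 1)) x := fun t x => by
    have h1 : HasDerivAt (fun y => deriv σ (u t y)) (deriv (deriv σ) (u t x) * b t x) x :=
      (hasDerivAt_deriv hσ (u t x)).comp x (hux t x)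
    exact (h1.fun_mul (hasDerivAt_snd hdb t x)).congr_deriv (by ring)
  refine ⟨a, b, fun t x => fderiv ℝ (fun p : ℝ × ℝ => a p.1 p.2) (t, x) (0, 1),
    fun t x => fderiv ℝ (fun p : ℝ × ℝ => b p.1 p.2) (t, x) (0, 1), hσ, hu.continuous,
    hca.continuous, hcb.continuous, ?_, ?_, ?_, hux, ?_, hvx, ?_, hasDerivAt_snd hda, ?_,
    hasDerivAt_snd hdb⟩
  · exact (hca.continuous_fderiv (by norm_num)).clm_apply continuous_const
  · exact (hcb.continuous_fderiv (by norm_num)).clm_apply continuous_const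
  · exact fun t x => by simpa only [hut'] using hasDerivAt_fst hdu t x
  · exact fun t x => by simpa only [hvt'] using hasDerivAt_fst hdv t x
  · intro t x
    convert hasDerivAt_fst hda t x using 1
    -- Symmetry of second derivatives: `a_t = v_xt = v_tx = (σ'(u) u_x)_x`.
    have h1 := fderiv_fderiv_comm hv (t, x) (0, 1) (1, 0)
    refine Eq.trans ?_ h1.symm
    have h2 := hasDerivAt_snd
      (f := fun s y => fderiv ℝ (fun p : ℝ × ℝ => v p.1 p.2) (s, y) (1, 0))
      (contDiff_fderiv_apply hv (1, 0) |>.differentiable (by norm_num)) t x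
    simp only [hvt'] at h2
    simp only [hvt']
    exact (hσu t x).unique h2
  · intro t x
    convert hasDerivAt_fst hdb t x using 1
    have h1 := fderiv_fderiv_comm hu (t, x) (0, 1) (1, 0)
    refine Eq.trans ?_ h1.symm
    have h2 := hasDerivAt_snd
      (f := fun s y => fderiv ℝ (fun p : ℝ × ℝ => u p.1 p.2) (s, y) (1, 0))
      (contDiff_fderiv_apply hu (1, 0) |>.differentiable (by norm_num)) t x
    simp only [hut'] at h2
    simp only [hut']
    exact ((hasDerivAt_snd hda t x).fun_neg).unique h2

/-! ### Periodicity of the gradient, and the elliptic region. -/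

namespace HasGradient

variable {σ : ℝ → ℝ} {u v a b ax bx : ℝ → ℝ → ℝ}

theorem comp_t (h : HasGradient σ u v a b ax bx) {g : ℝ → ℝ} {g' t x : ℝ}
    (hg : HasDerivAt g g' (u t x)) : HasDerivAt (fun s => g (u s x)) (g' * -a t x) t :=
  HasDerivAt.comp (h := fun s => u s x) t hg (h.u_t t x)

theorem comp_x (h : HasGradient σ u v a b ax bx) {g : ℝ → ℝ} {g' t x : ℝ}
    (hg : HasDerivAt g g' (u t x)) : HasDerivAt (fun y => g (u t y)) (g' * b t x) x :=
  HasDerivAt.comp x hg (h.u_x t x)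

/-- Although `v` need not be periodic, `v_x = -u_t` is. -/
theorem periodic_a (h : HasGradient σ u v a b ax bx) (hper : ∀ t x, u t (x + 1) = u t x) (t x : ℝ) :
    a t (x + 1) = a t x := by
  have h1 := h.u_t t (x + 1)
  simp only [hper] at h1
  exact neg_injective (h1.unique (h.u_t t x))

theorem periodic_b (h : HasGradient σ u v a b ax bx) (hper : ∀ t x, u t (x + 1) = u t x) (t x : ℝ) :
    b t (x + 1) = b t x := by
  have h1 := (h.u_x t (x + 1)).comp_add_const x 1
  simp only [hper] at h1
  exact h1.unique (h.u_x t x)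

theorem exists_eq_of_gradient_eq_zero (h : HasGradient σ u v a b ax bx) (ha : ∀ t x, a t x = 0)
    (hb : ∀ t x, b t x = 0) : ∃ c d : ℝ, ∀ t x, u t x = c ∧ v t x = d := by
  refine ⟨u 0 0, v 0 0, fun t x => ⟨?_, ?_⟩⟩
  · calc u t x = u 0 x := is_const_of_deriv_eq_zero (f := fun s => u s x)
          (fun s => (h.u_t s x).differentiableAt) (fun s => by rw [(h.u_t s x).deriv, ha, neg_zero]) t 0
      _ = u 0 0 := is_const_of_deriv_eq_zero (fun y => (h.u_x 0 y).differentiableAt)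
          (fun y => by rw [(h.u_x 0 y).deriv, hb]) x 0
  · calc v t x = v 0 x := is_const_of_deriv_eq_zero (f := fun s => v s x)
          (fun s => (h.v_t s x).differentiableAt)
          (fun s => by rw [(h.v_t s x).deriv, hb, mul_zero]) t 0
      _ = v 0 0 := is_const_of_deriv_eq_zero (fun y => (h.v_x 0 y).differentiableAt)
          (fun y => by rw [(h.v_x 0 y).deriv, ha]) x 0

/-- A bounded periodic solution is locally constant where the system is elliptic. -/
theorem eq_zero_of_elliptic (h : HasGradient σ u v a b ax bx)
    (hper : ∀ t x, u t (x + 1) = u t x) {M : ℝ} (hM : ∀ t x, |u t x| ≤ M) {t x : ℝ}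
    (hell : 0 < deriv σ (u t x)) : a t x = 0 ∧ b t x = 0 := by
  have hσ' : Continuous (deriv σ) := h.contDiff_σ.continuous_deriv (by norm_num)
  have hσ'' : Continuous (deriv (deriv σ)) := continuous_deriv_deriv h.contDiff_σ
  -- Taking `f'' = φ` discards the non-elliptic states, where `a² + σ'(u) b²` has no sign.
  set φ : ℝ → ℝ := fun w => max 0 (deriv σ w) with hφ
  have hφc : Continuous φ := by fun_prop
  set f' : ℝ → ℝ := fun w => ∫ z in (0 : ℝ)..w, φ z with hf'
  have hdf' : ∀ w, HasDerivAt f' (φ w) w := fun w => (hφc.integral_hasStrictDerivAt 0 w).hasDerivAt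
  have hf'c : Continuous f' := continuous_iff_continuousAt.2 fun w => (hdf' w).continuousAt
  set f : ℝ → ℝ := fun w => ∫ z in (0 : ℝ)..w, f' z with hf
  have hdf : ∀ w, HasDerivAt f (f' w) w := fun w => (hf'c.integral_hasStrictDerivAt 0 w).hasDerivAt
  have hfc : Continuous f := continuous_iff_continuousAt.2 fun w => (hdf w).continuousAt
  have hu := h.continuous_u
  have ha := h.continuous_a
  have hb := h.continuous_b
  have hbx := h.continuous_bx
  have hpa := h.periodic_a hper
  have hpb := h.periodic_b hper
  have hG : ∀ s, HasDerivAt (fun s => ∫ y in x..x + 1, f (u s y))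
      (∫ y in x..x + 1, f' (u s y) * -a s y) s := fun s =>
    hasDerivAt_intervalIntegral_of_continuous (F := fun s y => f (u s y))
      (Ft := fun s y => f' (u s y) * -a s y) (by fun_prop) (by fun_prop)
      (fun s y => h.comp_t (hdf (u s y))) x (x + 1) s
  have hG' : ∀ s, HasDerivAt (fun s => ∫ y in x..x + 1, f' (u s y) * -a s y)
      (∫ y in x..x + 1, φ (u s y) * (a s y ^ 2 + deriv σ (u s y) * b s y ^ 2)) s := fun s =>
    hasDerivAt_integral_of_balance (F := fun s y => f' (u s y) * -a s y)
      (Ft := fun s y => φ (u s y) * a s y ^ 2 -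
        f' (u s y) * (deriv (deriv σ) (u s y) * b s y ^ 2 + deriv σ (u s y) * bx s y))
      (J := fun s y => f' (u s y) * (deriv σ (u s y) * b s y))
      (Jx := fun s y => φ (u s y) * deriv σ (u s y) * b s y ^ 2 +
        f' (u s y) * (deriv (deriv σ) (u s y) * b s y ^ 2 + deriv σ (u s y) * bx s y))
      (g := fun s y => φ (u s y) * (a s y ^ 2 + deriv σ (u s y) * b s y ^ 2))
      (by fun_prop) (by fun_prop) (by fun_prop)
      (fun s y => by
        exact ((h.comp_t (hdf' (u s y))).fun_mul (h.a_t s y).fun_neg).congr_deriv (by ring))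
      (fun s y => by
        exact ((h.comp_x (hdf' (u s y))).fun_mul ((h.comp_x
          (hasDerivAt_deriv h.contDiff_σ (u s y))).fun_mul (h.b_x s y))).congr_deriv (by ring))
      (fun s y => by simp only [hper, hpb]) (fun s y => by ring) x s
  have hnn : ∀ s y, 0 ≤ φ (u s y) * (a s y ^ 2 + deriv σ (u s y) * b s y ^ 2) := fun s y => by
    rcases le_total (deriv σ (u s y)) 0 with hle | hle
    · simp [hφ, max_eq_left hle]
    · have : 0 ≤ φ (u s y) := le_max_left _ _
      positivity
  obtain ⟨C, hC⟩ := (isCompact_Icc (a := -M) (b := M)).exists_bound_of_continuousOn hfc.continuousOn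
  have hbd : ∀ s, |∫ y in x..x + 1, f (u s y)| ≤ C := fun s => by
    have := intervalIntegral.norm_integral_le_of_norm_le_const (a := x) (b := x + 1) (C := C)
      (f := fun y => f (u s y)) fun y _ => hC _ (abs_le.1 (hM s y))
    simpa using this
  have hzero := second_deriv_eq_zero_of_bounded hG hG'
    (fun s => intervalIntegral.integral_nonneg (by linarith) fun y _ => hnn s y) hbd t
  have hx := eq_zero_of_integral_eq_zero
    (g := fun y => φ (u t y) * (a t y ^ 2 + deriv σ (u t y) * b t y ^ 2))
    (by
      have h1 : Continuous fun y : ℝ => (t, y) := by fun_prop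
      have h2 := hu.comp h1
      have h3 := ha.comp h1
      have h4 := hb.comp h1
      simp only [Function.comp_def] at h2 h3 h4
      fun_prop) (hnn t) hzero
  have hφpos : 0 < φ (u t x) := lt_max_of_lt_right hell
  have hsum := (mul_eq_zero.1 hx).resolve_left hφpos.ne'
  have h1 : 0 ≤ deriv σ (u t x) * b t x ^ 2 := by positivity
  have h2 := sq_nonneg (a t x)
  refine ⟨pow_eq_zero_iff (two_ne_zero) |>.1 (by linarith), ?_⟩
  have h3 : deriv σ (u t x) * b t x ^ 2 = 0 := by linarith
  exact pow_eq_zero_iff (two_ne_zero) |>.1 ((mul_eq_zero.1 h3).resolve_left hell.ne')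

/-- Either the gradient of the solution vanishes or the system is nowhere elliptic along it. -/
theorem gradient_eq_zero_or_nonpos (h : HasGradient σ u v a b ax bx)
    (hper : ∀ t x, u t (x + 1) = u t x) {M : ℝ} (hM : ∀ t x, |u t x| ≤ M) :
    ((∀ t x, a t x = 0) ∧ ∀ t x, b t x = 0) ∨ ∀ t x, deriv σ (u t x) ≤ 0 := by
  by_contra! hcon
  obtain ⟨hne, t₀, x₀, hpos⟩ := hcon
  have hz : ∀ t x, max 0 (deriv σ (u t x)) = 0 ∨ a t x = 0 ∧ b t x = 0 := fun t x => by
    rcases le_or_gt (deriv σ (u t x)) 0 with hle | hlt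
    · exact Or.inl (max_eq_left hle)
    · exact Or.inr (h.eq_zero_of_elliptic hper hM hlt)
  have hdt : ∀ t x, HasDerivAt (fun s => max 0 (deriv σ (u s x)) ^ 2) 0 t := fun t x => by
    refine (HasDerivAt.comp (h := fun s => deriv σ (u s x)) t (hasDerivAt_max_zero_sq _)
      (h.comp_t (hasDerivAt_deriv h.contDiff_σ (u t x)))).congr_deriv ?_
    rcases hz t x with h0 | ⟨h0, -⟩ <;> simp [h0]
  have hdx : ∀ t x, HasDerivAt (fun y => max 0 (deriv σ (u t y)) ^ 2) 0 x := fun t x => by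
    refine (HasDerivAt.comp (h := fun y => deriv σ (u t y)) x (hasDerivAt_max_zero_sq _)
      (h.comp_x (hasDerivAt_deriv h.contDiff_σ (u t x)))).congr_deriv ?_
    rcases hz t x with h0 | ⟨-, h0⟩ <;> simp [h0]
  have hconst : ∀ t x, max 0 (deriv σ (u t x)) ^ 2 = max 0 (deriv σ (u t₀ x₀)) ^ 2 := fun t x =>
    (is_const_of_deriv_eq_zero (f := fun s => max 0 (deriv σ (u s x)) ^ 2)
      (fun s => (hdt s x).differentiableAt) (fun s => (hdt s x).deriv) t t₀).trans
    (is_const_of_deriv_eq_zero (f := fun y => max 0 (deriv σ (u t₀ y)) ^ 2)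
      (fun y => (hdx t₀ y).differentiableAt) (fun y => (hdx t₀ y).deriv) x x₀)
  have hall : ∀ t x, a t x = 0 ∧ b t x = 0 := fun t x => (hz t x).resolve_left fun h0 => by
    have h1 := hconst t x
    rw [h0, max_eq_right hpos.le] at h1
    have := pow_pos hpos 2
    linarith
  obtain ⟨t, x, hb⟩ := hne fun t x => (hall t x).1
  exact hb (hall t x).2

end HasGradient

/-! ### The weighted fifth moment and its balance law. -/

section FifthMoment

/-- The polynomial `c ^ 2 * (a + c * b) ^ 5`, written in terms of `S = c ^ 2` and `T = c ^ 3`, which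
unlike `c` are continuously differentiable up to the parabolic line. -/
def momentDensity (S T a b : ℝ) : ℝ :=
  S * (a ^ 5 + 10 * a ^ 3 * b ^ 2 * S + 5 * a * b ^ 4 * S ^ 2) +
    T * (5 * a ^ 4 * b + 10 * a ^ 2 * b ^ 3 * S + b ^ 5 * S ^ 2)

/-- The polynomial `c ^ 3 * (a + c * b) ^ 5`, written in terms of `S = c ^ 2` and `T = c ^ 3`. -/
def momentFlux (S T a b : ℝ) : ℝ :=
  T * (a ^ 5 + 10 * a ^ 3 * b ^ 2 * S + 5 * a * b ^ 4 * S ^ 2) +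
    S ^ 2 * (5 * a ^ 4 * b + 10 * a ^ 2 * b ^ 3 * S + b ^ 5 * S ^ 2)

/-- The derivative of `momentDensity` at `(S, T, a, b)` in the direction `(S', T', a', b')`. -/
def momentDensityDeriv (S T a b S' T' a' b' : ℝ) : ℝ :=
  S' * (a ^ 5 + 20 * a ^ 3 * b ^ 2 * S + 15 * a * b ^ 4 * S ^ 2) +
    S * (a' * (5 * a ^ 4 + 30 * a ^ 2 * b ^ 2 * S + 5 * b ^ 4 * S ^ 2) +
      b' * (20 * a ^ 3 * b * S + 20 * a * b ^ 3 * S ^ 2)) +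
    T' * (5 * a ^ 4 * b + 10 * a ^ 2 * b ^ 3 * S + b ^ 5 * S ^ 2) +
    T * (a' * (20 * a ^ 3 * b + 20 * a * b ^ 3 * S) +
      b' * (5 * a ^ 4 + 30 * a ^ 2 * b ^ 2 * S + 5 * b ^ 4 * S ^ 2) +
      S' * (10 * a ^ 2 * b ^ 3 + 2 * b ^ 5 * S))

/-- The derivative of `momentFlux` at `(S, T, a, b)` in the direction `(S', T', a', b')`. -/
def momentFluxDeriv (S T a b S' T' a' b' : ℝ) : ℝ :=
  T' * (a ^ 5 + 10 * a ^ 3 * b ^ 2 * S + 5 * a * b ^ 4 * S ^ 2) +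
    T * (a' * (5 * a ^ 4 + 30 * a ^ 2 * b ^ 2 * S + 5 * b ^ 4 * S ^ 2) +
      b' * (20 * a ^ 3 * b * S + 20 * a * b ^ 3 * S ^ 2) +
      S' * (10 * a ^ 3 * b ^ 2 + 10 * a * b ^ 4 * S)) +
    S' * (10 * a ^ 4 * b * S + 30 * a ^ 2 * b ^ 3 * S ^ 2 + 4 * b ^ 5 * S ^ 3) +
    S ^ 2 * (a' * (20 * a ^ 3 * b + 20 * a * b ^ 3 * S) +
      b' * (5 * a ^ 4 + 30 * a ^ 2 * b ^ 2 * S + 5 * b ^ 4 * S ^ 2))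

theorem momentDensity_eq (c a b : ℝ) :
    momentDensity (c ^ 2) (c ^ 3) a b = c ^ 2 * (a + c * b) ^ 5 := by
  rw [momentDensity]; ring

/-- Formally `p_t + c p_x = d b p / (2c)` for `p = a + c b`. For `c^k p^n` with flux `c^(k+1) p^n`
the source is a multiple of `p^(n+1)` when `n = 2k + 1`, namely `(k/2) d c^(k-2) p^(n+1)`; `k = 2`
removes `c` from it. -/
theorem momentDensityDeriv_add_momentFluxDeriv (c a b ax bx d : ℝ) :
    momentDensityDeriv (c ^ 2) (c ^ 3) a b (d * a) (3 / 2 * c * (d * a))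
        (d * b ^ 2 - c ^ 2 * bx) (-ax) +
      momentFluxDeriv (c ^ 2) (c ^ 3) a b (-(d * b)) (3 / 2 * c * -(d * b)) ax bx =
      d * (a + c * b) ^ 6 := by
  rw [momentDensityDeriv, momentFluxDeriv]; ring

variable {S T a b : ℝ → ℝ} {S' T' a' b' z : ℝ}

theorem hasDerivAt_momentDensity (hS : HasDerivAt S S' z) (hT : HasDerivAt T T' z)
    (ha : HasDerivAt a a' z) (hb : HasDerivAt b b' z) :
    HasDerivAt (fun z => momentDensity (S z) (T z) (a z) (b z))
      (momentDensityDeriv (S z) (T z) (a z) (b z) S' T' a' b') z := by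
  have h1 := (((ha.fun_pow 5).fun_add ((((ha.fun_pow 3).const_mul 10).fun_mul (hb.fun_pow 2)).fun_mul hS)).fun_add
    (((ha.const_mul 5).fun_mul (hb.fun_pow 4)).fun_mul (hS.fun_pow 2)))
  have h2 := ((((ha.fun_pow 4).const_mul 5).fun_mul hb).fun_add
    ((((ha.fun_pow 2).const_mul 10).fun_mul (hb.fun_pow 3)).fun_mul hS)).fun_add
    ((hb.fun_pow 5).fun_mul (hS.fun_pow 2))
  refine ((hS.fun_mul h1).fun_add (hT.fun_mul h2)).congr_deriv ?_
  rw [momentDensityDeriv]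
  push_cast
  ring

theorem hasDerivAt_momentFlux (hS : HasDerivAt S S' z) (hT : HasDerivAt T T' z)
    (ha : HasDerivAt a a' z) (hb : HasDerivAt b b' z) :
    HasDerivAt (fun z => momentFlux (S z) (T z) (a z) (b z))
      (momentFluxDeriv (S z) (T z) (a z) (b z) S' T' a' b') z := by
  have h1 := (((ha.fun_pow 5).fun_add ((((ha.fun_pow 3).const_mul 10).fun_mul (hb.fun_pow 2)).fun_mul hS)).fun_add
    (((ha.const_mul 5).fun_mul (hb.fun_pow 4)).fun_mul (hS.fun_pow 2)))
  have h2 := ((((ha.fun_pow 4).const_mul 5).fun_mul hb).fun_add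
    ((((ha.fun_pow 2).const_mul 10).fun_mul (hb.fun_pow 3)).fun_mul hS)).fun_add
    ((hb.fun_pow 5).fun_mul (hS.fun_pow 2))
  refine ((hT.fun_mul h1).fun_add ((hS.fun_pow 2).fun_mul h2)).congr_deriv ?_
  rw [momentFluxDeriv]
  push_cast
  ring

/-- At `0` the difference quotient is `√w`, which tends to `0` from both sides because `√` is zero
on negative numbers. -/
theorem hasDerivAt_mul_sqrt {z : ℝ} (hz : 0 ≤ z) :
    HasDerivAt (fun w => w * √w) (3 / 2 * √z) z := by
  rcases hz.eq_or_lt with rfl | hz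
  · rw [hasDerivAt_iff_tendsto_slope_zero]
    simp only [zero_add, Real.sqrt_zero, mul_zero, sub_zero, smul_eq_mul]
    have h : Tendsto (fun w : ℝ => √w) (𝓝[≠] 0) (𝓝 0) := by
      have := (Real.continuous_sqrt.tendsto 0).mono_left (nhdsWithin_le_nhds (s := {0}ᶜ))
      rwa [Real.sqrt_zero] at this
    refine h.congr' ?_
    filter_upwards [self_mem_nhdsWithin] with w hw
    rw [inv_mul_cancel_left₀ hw]
  · refine ((hasDerivAt_id z).fun_mul (Real.hasDerivAt_sqrt hz.ne')).congr_deriv ?_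
    have h : √z ≠ 0 := (Real.sqrt_pos.2 hz).ne'
    have h2 : √z ^ 2 = z := Real.sq_sqrt hz.le
    simp only [id]
    field_simp
    rw [h2]; ring

end FifthMoment

/-! ### The hyperbolic region, up to the parabolic line. -/

namespace HasGradient

variable {σ : ℝ → ℝ} {u v a b ax bx : ℝ → ℝ → ℝ}

/-- In the genuinely nonlinear hyperbolic regime the derivative of a Riemann invariant along the
`x`-axis vanishes. Here `δ = ±1` selects the characteristic family and `ε = ±1` is the sign of
`σ''`. -/
theorem riemannInvariant_deriv_eq_zero (h : HasGradient σ u v a b ax bx)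
    (hper : ∀ t x, u t (x + 1) = u t x) (hhyp : ∀ t x, deriv σ (u t x) ≤ 0)
    {N : ℝ} (hN : ∀ t x, -deriv σ (u t x) ≤ N) {m ε δ : ℝ} (hm : 0 < m) (hε : |ε| = 1)
    (hnl : ∀ t x, m ≤ ε * deriv (deriv σ) (u t x)) (hδ : δ ^ 2 = 1) (t x : ℝ) :
    a t x + δ * √(-deriv σ (u t x)) * b t x = 0 := by
  wlog hN0 : 0 < N generalizing N
  · exact this (N := max N 1) (fun t x => (hN t x).trans (le_max_left _ _))
      (lt_max_of_lt_right one_pos)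
  have hσ' : Continuous (deriv σ) := h.contDiff_σ.continuous_deriv (by norm_num)
  have hσ'' : Continuous (deriv (deriv σ)) := continuous_deriv_deriv h.contDiff_σ
  have hu := h.continuous_u
  have ha := h.continuous_a
  have hb := h.continuous_b
  have hax := h.continuous_ax
  have hbx := h.continuous_bx
  have hpa := h.periodic_a hper
  have hpb := h.periodic_b hper
  set c : ℝ → ℝ → ℝ := fun t x => δ * √(-deriv σ (u t x)) with hc
  have hcc : Continuous fun p : ℝ × ℝ => c p.1 p.2 := by fun_prop
  set p : ℝ → ℝ → ℝ := fun t x => a t x + c t x * b t x with hp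
  have hpc : Continuous fun q : ℝ × ℝ => p q.1 q.2 := by fun_prop
  have hc2 : ∀ t x, c t x ^ 2 = -deriv σ (u t x) := fun t x => by
    rw [hc, mul_pow, hδ, one_mul, Real.sq_sqrt (by linarith [hhyp t x])]
  have hS : ∀ w, HasDerivAt (fun w => -deriv σ w) (-deriv (deriv σ) w) w := fun w =>
    (hasDerivAt_deriv h.contDiff_σ w).fun_neg
  have hSt : ∀ t x, HasDerivAt (fun s => c s x ^ 2) (deriv (deriv σ) (u t x) * a t x) t :=
    fun t x => by
      simp only [hc2]
      exact (h.comp_t (hS (u t x))).congr_deriv (by ring)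
  have hSx : ∀ t x, HasDerivAt (fun y => c t y ^ 2) (-(deriv (deriv σ) (u t x) * b t x)) x :=
    fun t x => by
      simp only [hc2]
      exact (h.comp_x (hS (u t x))).congr_deriv (by ring)
  have hcube : ∀ t x, c t x ^ 3 = δ * (c t x ^ 2 * √(c t x ^ 2)) := fun t x => by
    rw [pow_succ, mul_left_comm]
    congr 1
    rw [hc2]
  have hT : ∀ t x, HasDerivAt (fun w => δ * (w * √w)) (3 / 2 * c t x) (c t x ^ 2) :=
    fun t x => ((hasDerivAt_mul_sqrt (sq_nonneg (c t x))).const_mul δ).congr_deriv (by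
      rw [hc2]; ring)
  have hTt : ∀ t x, HasDerivAt (fun s => c s x ^ 3)
      (3 / 2 * c t x * (deriv (deriv σ) (u t x) * a t x)) t := fun t x => by
    simp only [hcube]
    exact HasDerivAt.comp (h := fun s => c s x ^ 2) t (hT t x) (hSt t x)
  have hTx : ∀ t x, HasDerivAt (fun y => c t y ^ 3)
      (3 / 2 * c t x * -(deriv (deriv σ) (u t x) * b t x)) x := fun t x => by
    simp only [hcube]
    exact HasDerivAt.comp (h := fun y => c t y ^ 2) x (hT t x) (hSx t x)
  have hat : ∀ t x, HasDerivAt (fun s => a s x)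
      (deriv (deriv σ) (u t x) * b t x ^ 2 - c t x ^ 2 * bx t x) t := fun t x =>
    (h.a_t t x).congr_deriv (by rw [hc2]; ring)
  set F : ℝ → ℝ → ℝ := fun t x => ε * momentDensity (c t x ^ 2) (c t x ^ 3) (a t x) (b t x) with hF
  set g : ℝ → ℝ → ℝ := fun t x => ε * deriv (deriv σ) (u t x) * p t x ^ 6 with hg
  have hgc : Continuous fun q : ℝ × ℝ => g q.1 q.2 := by fun_prop
  have hFc : Continuous fun q : ℝ × ℝ => F q.1 q.2 := by
    simp only [hF, momentDensity_eq]
    fun_prop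
  have hY := hasDerivAt_integral_of_balance (F := F)
    (Ft := fun t x => ε * momentDensityDeriv (c t x ^ 2) (c t x ^ 3) (a t x) (b t x)
      (deriv (deriv σ) (u t x) * a t x) (3 / 2 * c t x * (deriv (deriv σ) (u t x) * a t x))
      (deriv (deriv σ) (u t x) * b t x ^ 2 - c t x ^ 2 * bx t x) (-ax t x))
    (J := fun t x => ε * momentFlux (c t x ^ 2) (c t x ^ 3) (a t x) (b t x))
    (Jx := fun t x => ε * momentFluxDeriv (c t x ^ 2) (c t x ^ 3) (a t x) (b t x)
      (-(deriv (deriv σ) (u t x) * b t x)) (3 / 2 * c t x * -(deriv (deriv σ) (u t x) * b t x))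
      (ax t x) (bx t x)) (g := g) hFc
    (by simp only [momentDensityDeriv]; fun_prop) (by simp only [momentFluxDeriv]; fun_prop)
    (fun t x => (hasDerivAt_momentDensity (hSt t x) (hTt t x) (hat t x) (h.b_t t x)).const_mul ε)
    (fun t x => (hasDerivAt_momentFlux (hSx t x) (hTx t x) (h.a_x t x) (h.b_x t x)).const_mul ε)
    (fun t x => by simp only [hc, hper, hpa, hpb])
    (fun t x => by rw [← mul_add, momentDensityDeriv_add_momentFluxDeriv, ← mul_assoc]) x
  have hslice : ∀ {f : ℝ → ℝ → ℝ} (t : ℝ), (Continuous fun q : ℝ × ℝ => f q.1 q.2) →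
      Continuous (f t) := fun t hf => hf.comp (by fun_prop : Continuous fun y : ℝ => (t, y))
  have hlower : ∀ t x, m * p t x ^ 6 ≤ g t x := fun t x => by
    have : 0 ≤ p t x ^ 6 := by positivity
    exact mul_le_mul_of_nonneg_right (hnl t x) this
  have hg0 : ∀ t x, 0 ≤ g t x := fun t x => le_trans (by positivity) (hlower t x)
  -- Hölder applies since `|F| = c² |p|⁵ ≤ N |p|⁵`.
  have hgrowth : ∀ t, m / N ^ (6 / 5 : ℝ) * |∫ y in x..x + 1, F t y| ^ (6 / 5 : ℝ) ≤
      ∫ y in x..x + 1, g t y := fun t => by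
    have hpt : Continuous (p t) := hslice t hpc
    have h1 := rpow_abs_integral_le (hslice t hFc) hpt hN0 (fun y => by
      simp only [hF, momentDensity_eq, abs_mul, abs_pow, hε, one_mul]
      rw [← abs_pow (c t y), abs_of_nonneg (sq_nonneg (c t y)), hc2]
      gcongr
      exact hN t y) x
    have h2 : ∫ y in x..x + 1, m * p t y ^ 6 ≤ ∫ y in x..x + 1, g t y :=
      intervalIntegral.integral_mono_on (by linarith)
        (Continuous.intervalIntegrable (by fun_prop) _ _)
        ((hslice t hgc).intervalIntegrable _ _) fun y _ => hlower t y
    rw [intervalIntegral.integral_const_mul] at h2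
    refine le_trans ?_ h2
    have hNp : 0 < N ^ (6 / 5 : ℝ) := by positivity
    rw [div_mul_eq_mul_div, div_le_iff₀ hNp]
    calc _ ≤ m * (N ^ (6 / 5 : ℝ) * ∫ y in x..x + 1, p t y ^ 6) := by gcongr
      _ = _ := by ring
  have hYz := eq_zero_of_superlinear_growth hY (by positivity) hgrowth
  have hint : ∫ y in x..x + 1, g t y = 0 := by
    have h1 := hY t
    rw [funext hYz] at h1
    exact h1.unique (hasDerivAt_const t 0)
  have hgz := eq_zero_of_integral_eq_zero (hslice t hgc) (hg0 t) hint
  have h6 : p t x ^ 6 ≤ 0 := by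
    have h1 := hlower t x
    rw [hgz] at h1
    by_contra! h2
    have := mul_pos hm h2
    linarith
  exact pow_eq_zero_iff (by norm_num) |>.1 (le_antisymm h6 (by positivity))

/-- A bounded periodic solution taking values in a genuinely nonlinear hyperbolic zone, possibly
touching the parabolic line, has zero gradient. -/
theorem gradient_eq_zero_of_hyperbolic (h : HasGradient σ u v a b ax bx)
    (hper : ∀ t x, u t (x + 1) = u t x) (hhyp : ∀ t x, deriv σ (u t x) ≤ 0)
    {K : Set ℝ} (hK : IsCompact K) (huK : ∀ t x, u t x ∈ K) {ε : ℝ} (hε : |ε| = 1)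
    (hnl : ∀ w ∈ K, 0 < ε * deriv (deriv σ) w) (t x : ℝ) : a t x = 0 ∧ b t x = 0 := by
  have hσ' : Continuous (deriv σ) := h.contDiff_σ.continuous_deriv (by norm_num)
  have hσ'' : Continuous (deriv (deriv σ)) := continuous_deriv_deriv h.contDiff_σ
  obtain ⟨N, hN⟩ := hK.exists_bound_of_continuousOn hσ'.continuousOn
  obtain ⟨w₀, hw₀, hmin⟩ := hK.exists_isMinOn ⟨_, huK 0 0⟩
    (continuous_const.mul hσ'' : Continuous fun w => ε * deriv (deriv σ) w).continuousOn
  have hR := fun (δ : ℝ) (hδ : δ ^ 2 = 1) => h.riemannInvariant_deriv_eq_zero hper hhyp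
    (fun t x => (neg_le_abs _).trans (hN _ (huK t x))) (hnl w₀ hw₀) hε
    (fun t x => hmin (huK t x)) hδ t x
  have h1 := hR 1 (by norm_num)
  have h2 := hR (-1) (by norm_num)
  refine ⟨by linarith, ?_⟩
  -- Where the speed vanishes, `c b = 0` is empty; but there `σ'(u) ≤ 0` attains its maximum, so
  -- `σ''(u) b = 0`.
  rcases (hhyp t x).eq_or_lt with h0 | h0
  · have hmax : IsLocalMax (fun y => deriv σ (u t y)) x :=
      Eventually.of_forall fun y => (hhyp t y).trans h0.ge
    have h3 := hmax.hasDerivAt_eq_zero (h.comp_x (hasDerivAt_deriv h.contDiff_σ (u t x)))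
    refine (mul_eq_zero.1 h3).resolve_left fun h4 => ?_
    have := hnl _ (huK t x)
    rw [h4, mul_zero] at this
    exact this.false
  · have hpos : 0 < √(-deriv σ (u t x)) := Real.sqrt_pos.2 (by linarith)
    have h3 : √(-deriv σ (u t x)) * b t x = 0 := by linarith
    exact (mul_eq_zero.1 h3).resolve_left hpos.ne'

end HasGradient

/-! ### Locating the range of `u` for each type. -/

/-- A differentiable strictly convex function has positive derivative to the right of its minimum. -/
theorem deriv_pos_of_isMinOn_of_lt {σ : ℝ → ℝ} (hσ : Differentiable ℝ σ)
    (hconv : StrictConvexOn ℝ Set.univ σ) {α w : ℝ} (hα : IsMinOn σ Set.univ α) (hw : α < w) :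
    0 < deriv σ w := by
  have hlt : σ α < σ w := by
    refine lt_of_le_of_ne (hα (Set.mem_univ w)) fun heq => hw.ne ?_
    refine hconv.eq_of_isMinOn hα (fun z hz => ?_) (Set.mem_univ _) (Set.mem_univ _)
    simpa only [Set.mem_ofPred_eq, ← heq] using hα hz
  have h1 := hconv.convexOn.slope_le_deriv (Set.mem_univ α) (Set.mem_univ w) hw (hσ w)
  refine lt_of_lt_of_le ?_ h1
  rw [slope_def_field]
  exact div_pos (sub_pos.2 hlt) (sub_pos.2 hw)

end PSystem

theorem theorem4 (σ : ℝ → ℝ) (hσ : PSystem.IsTypeI σ ∨ PSystem.IsTypeII σ)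
    (u v : ℝ → ℝ → ℝ) (hsol : PSystem.IsC2Solution σ u v)
    (hbdd : ∃ M : ℝ, ∀ t x : ℝ, |u t x| ≤ M)
    (hper : ∀ t x : ℝ, u t (x + 1) = u t x) :
    ∃ a b : ℝ, ∀ t x : ℝ, u t x = a ∧ v t x = b := by
  have hC2 : ContDiff ℝ 2 σ := hσ.elim (·.contDiff) (·.contDiff)
  obtain ⟨M, hM⟩ := hbdd
  obtain ⟨a, b, ax, bx, h⟩ := hsol.exists_hasGradient hC2
  rcases h.gradient_eq_zero_or_nonpos hper hM with ⟨ha, hb⟩ | hhyp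
  · exact h.exists_eq_of_gradient_eq_zero ha hb
  have hM' := fun t x => abs_le.1 (hM t x)
  have main : ∀ (l r ε : ℝ), |ε| = 1 → (∀ t x, u t x ∈ Set.Icc l r) →
      (∀ w ∈ Set.Icc l r, 0 < ε * deriv (deriv σ) w) →
      ∃ a b : ℝ, ∀ t x : ℝ, u t x = a ∧ v t x = b := fun l r ε hε hu hnl =>
    have hz := h.gradient_eq_zero_of_hyperbolic hper hhyp isCompact_Icc hu hε hnl
    h.exists_eq_of_gradient_eq_zero (fun t x => (hz t x).1) fun t x => (hz t x).2
  rcases hσ with hI | hII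
  · obtain ⟨α, hα, hnl⟩ := hI.exists_min
    refine main (-M) α 1 abs_one (fun t x => ⟨(hM' t x).1, ?_⟩)
      fun w hw => by simpa using hnl w hw.2
    by_contra! hlt
    exact (hhyp t x).not_gt (PSystem.deriv_pos_of_isMinOn_of_lt
      (hC2.differentiable (by norm_num)) hI.strictConvex hα hlt)
  · obtain ⟨α, β, hαβ, -, -, hell, hnα, hnβ⟩ := hII.exists_zones
    have hzone : ∀ t x, u t x ≤ α ∨ β ≤ u t x := fun t x => by
      by_contra! hlt
      exact (hhyp t x).not_gt (hell _ hlt)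
    have hside : (∀ t x, u t x ≤ α) ∨ ∀ t x, β ≤ u t x := by
      by_contra! hcon
      obtain ⟨⟨t₁, x₁, h₁⟩, t₂, x₂, h₂⟩ := hcon
      -- Values on both sides of the gap would force a value inside it, as the plane is connected.
      have hmid : (α + β) / 2 ∈ Set.range fun p : ℝ × ℝ => u p.1 p.2 :=
        mem_range_of_exists_le_of_exists_ge h.continuous_u
          ⟨(t₂, x₂), by linarith [(hzone t₂ x₂).resolve_right h₂.not_ge]⟩
          ⟨(t₁, x₁), by linarith [(hzone t₁ x₁).resolve_left h₁.not_ge]⟩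
      obtain ⟨⟨t, x⟩, htx⟩ := hmid
      simp only at htx
      rcases hzone t x with hle | hle <;> linarith
    rcases hside with hle | hle
    · exact main (-M) α 1 abs_one (fun t x => ⟨(hM' t x).1, hle t x⟩)
        fun w hw => by simpa using hnα w hw.2
    · exact main β M (-1) (by simp) (fun t x => ⟨hle t x, (hM' t x).2⟩)
        fun w hw => by simpa using hnβ w hw.1
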